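/- Let $\rho:\mathbb{R}\to\mathbb{R}$ be continuous and not a polynomial function. Let $\mathcal S\subset\mathbb{R}^d$ and $\mathcal T\subset\mathbb{R}^{d'}$ be domains, possibly non-compact; here a domain is a locally compact subset that is contained in the closure of its interior (for example any open set, or the closure of any open set). For a locally compact space $X$ let $\mathcal C(X)$ be the space of continuous functions $X\to\mathbb{R}$, with the topology of uniform convergence on compact sets, and $\mathcal C_0(X)\subset\mathcal C(X)$ the space of those vanishing at infinity, with the supremum norm. A bounded affine map $A:\mathcal C(X)\to\mathcal C(Y)$ is a map $$A[x](t)=W[x](t)+b(t)=\int_X w(t,s)\,x(s)\,d\mu(s)+b(t),$$ where $\mu$ is a regular Borel measure on $X$, $w(t,\cdot)\in L^1_\mu(X)$ and $w(t,\cdot)x\in L^1_\mu(X)$ for all $t\in Y$, $x\in\mathcal C(X)$, the linear map $W:\mathcal C(X)\to\mathcal C(Y)$ is continuous, and $b\in\mathcal C(Y)$. Let $F:\mathcal C_0(\mathcal S)\to\mathcal C_0(\mathcal T)$ be a Lipschitz map with respect to the supremum norms. Then for every compact set $E\subset\mathcal C_0(\mathcal S)$ and every $\epsilon>0$ there exist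 $N\in\mathbb{N}$, $N\ge 1$, and bounded affine maps $A_1:\mathcal C(\mathcal S)\to\mathcal C([N])=\mathbb{R}^N$ and $A_2:\mathcal C([N])=\mathbb{R}^N\to\mathcal C(\mathcal T)$, where $[N]=\{1,\dots,N\}$ is discrete, such that the measure of $A_1$ is the Lebesgue measure on $\mathcal S$, $A_2$ takes values in $\mathcal C_0(\mathcal T)$, and the two-layer fully connected neural network $\phi_E=A_2\circ\rho\circ A_1$ ($\rho$ acting by $x\mapsto\rho\circ x$) satisfies $$\|F|_E-\phi_E\|_\infty=\sup_{x\in E}\,\sup_{t\in\mathcal T}\,|F[x](t)-\phi_E[x](t)|<\epsilon .$$ -/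

import Mathlib

open MeasureTheory Filter Topology
open scoped ZeroAtInfty ENNReal

/-- A (not necessarily compact) domain of `ℝ^d`: a locally compact subset which is contained in the
closure of its interior. Every open set is one, and so is the closure of every open set; in
particular neither openness nor compactness nor connectedness is required. -/
structure IsEuclideanDomain {d : ℕ} (S : Set (EuclideanSpace ℝ (Fin d))) : Prop where
  locallyCompact : LocallyCompactSpace S
  subset_closure_interior : S ⊆ closure (interior S)

/-- A bounded affine map `A[x] = W[x] + b` from `C(S)` to `C(T)` in integral form,
`A[x](t) = ∫ w(t, s) x(s) dμ(s) + b(t)`, for a regular measure `μ` on `S` and kernels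
`w(t, ·) ∈ L¹(μ)`. The linear part `W` is bounded, i.e. continuous for the topologies of uniform
convergence on compact sets (the supremum norm when the underlying space is compact). -/
structure BoundedAffineMap (S T : Type*) [TopologicalSpace S] [MeasurableSpace S]
    [TopologicalSpace T] where
  /-- the measure of the integral form -/
  measure : Measure S
  regular : measure.Regular
  /-- the kernel `w(t, s)` -/
  kernel : T → S → ℝ
  integrable_kernel : ∀ t, Integrable (kernel t) measure
  /-- the linear part `W` -/
  linear : C(S, ℝ) →L[ℝ] C(T, ℝ)
  integrable_kernel_mul : ∀ (x : C(S, ℝ)) (t : T), Integrable (fun s => kernel t s * x s) measure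
  linear_apply : ∀ (x : C(S, ℝ)) (t : T), linear x t = ∫ s, kernel t s * x s ∂measure
  /-- the bias `b` -/
  bias : C(T, ℝ)

/-- The value `A[x] = W[x] + b`. -/
def BoundedAffineMap.eval {S T : Type*} [TopologicalSpace S] [MeasurableSpace S]
    [TopologicalSpace T] (A : BoundedAffineMap S T) (x : C(S, ℝ)) : C(T, ℝ) :=
  A.linear x + A.bias

/-- The activation map `x ↦ ρ ∘ x` on `C(S)`. -/
def activationMap {S : Type*} [TopologicalSpace S] (ρ : C(ℝ, ℝ)) (x : C(S, ℝ)) : C(S, ℝ) :=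
  ρ.comp x

/-- The two-layer fully connected neural network `A₂ ∘ ρ ∘ A₁ : C(S₀) → C(S₂)`. -/
def twoLayerFNN {S₀ S₁ S₂ : Type*} [TopologicalSpace S₀] [MeasurableSpace S₀]
    [TopologicalSpace S₁] [MeasurableSpace S₁] [TopologicalSpace S₂] (ρ : C(ℝ, ℝ))
    (A₁ : BoundedAffineMap S₀ S₁) (A₂ : BoundedAffineMap S₁ S₂) (x : C(S₀, ℝ)) : C(S₂, ℝ) :=
  A₂.eval (activationMap ρ (A₁.eval x))

/-- `‖F|_E - φ‖_∞ = sup_{x ∈ E} sup_{t ∈ T} |F[x](t) - φ[x](t)|`, as an extended number. -/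
noncomputable def supDistOn {S T : Type*} [TopologicalSpace S] [TopologicalSpace T]
    (E : Set C₀(S, ℝ)) (F : C₀(S, ℝ) → C₀(T, ℝ)) (φ : C(S, ℝ) → C(T, ℝ)) : ℝ≥0∞ :=
  ⨆ x ∈ E, ⨆ t : T, ENNReal.ofReal |F x t - φ x.toContinuousMap t|

/-- A smooth function whose `k`-th derivative vanishes is a combination of `1, x, …, x ^ (k - 1)`. -/
theorem exists_sum_pow_of_iteratedDeriv_eq_zero (k : ℕ) {f : ℝ → ℝ}
    (hf : ContDiff ℝ (⊤ : ℕ∞) f) (h : ∀ x, iteratedDeriv k f x = 0) :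
    ∃ c : ℕ → ℝ, ∀ x, f x = ∑ i ∈ Finset.range k, c i * x ^ i := by
  induction k generalizing f with
  | zero => exact ⟨0, fun x => by simpa using h x⟩
  | succ k ih =>
    have hf' : ContDiff ℝ (⊤ : ℕ∞) (deriv f) := (contDiff_infty_iff_deriv.1 hf).2
    obtain ⟨c, hc⟩ := ih hf' fun x => by simpa [iteratedDeriv_succ'] using h x
    let g : ℝ → ℝ := fun x => ∑ i ∈ Finset.range k, c i / (i + 1) * x ^ (i + 1)
    have hg : ∀ x, HasDerivAt g (deriv f x) x := by
      intro x
      rw [hc]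
      refine HasDerivAt.fun_sum fun i _ => ?_
      refine ((hasDerivAt_pow (i + 1) x).const_mul (c i / (i + 1))).congr_deriv ?_
      have : (i : ℝ) + 1 ≠ 0 := by positivity
      push_cast
      field_simp
    have hd : ∀ x, HasDerivAt (f - g) 0 x := fun x => by
      have h1 : HasDerivAt f (deriv f x) x :=
        ((contDiff_infty_iff_deriv.1 hf).1 x).hasDerivAt
      simpa using h1.sub (hg x)
    refine ⟨fun i => if i = 0 then f 0 else c (i - 1) / ((i - 1 : ℕ) + 1), fun x => ?_⟩
    have := is_const_of_deriv_eq_zero (fun x => (hd x).differentiableAt) (fun x => (hd x).deriv) x 0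
    simp only [Pi.sub_apply] at this
    have h0 : g 0 = 0 := by simp [g]
    rw [Finset.sum_range_succ']
    simp only [Nat.add_eq_zero_iff, one_ne_zero, and_false, if_false, Nat.add_sub_cancel, if_true,
      pow_zero, mul_one]
    change f x = g x + f 0
    linarith

/-- A smooth function whose `k`-th derivative vanishes is a polynomial of degree less than `k`. -/
theorem exists_polynomial_of_iteratedDeriv_eq_zero (k : ℕ) {f : ℝ → ℝ}
    (hf : ContDiff ℝ (⊤ : ℕ∞) f) (h : ∀ x, iteratedDeriv k f x = 0) :
    ∃ p : Polynomial ℝ, p.degree < k ∧ ∀ x, f x = p.eval x := by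
  obtain ⟨c, hc⟩ := exists_sum_pow_of_iteratedDeriv_eq_zero k hf h
  refine ⟨∑ i ∈ Finset.range k, Polynomial.C (c i) * Polynomial.X ^ i, ?_, fun x => ?_⟩
  · rw [Polynomial.degree_lt_iff_coeff_zero]
    intro m hm
    simp only [Polynomial.finsetSum_coeff, Polynomial.coeff_C_mul_X_pow]
    exact Finset.sum_eq_zero fun i hi => if_neg (by have := Finset.mem_range.1 hi; omega)
  · simp [hc, Polynomial.eval_finsetSum]

/-- A pointwise limit of polynomials of bounded degree is a polynomial. -/
theorem exists_polynomial_of_tendsto (k : ℕ) {f : ℕ → ℝ → ℝ} {g : ℝ → ℝ}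
    (hf : ∀ n, ∃ p : Polynomial ℝ, p.degree < k ∧ ∀ x, f n x = p.eval x)
    (h : ∀ x, Tendsto (fun n => f n x) atTop (𝓝 (g x))) :
    ∃ p : Polynomial ℝ, ∀ x, g x = p.eval x := by
  choose p hpd hp using hf
  let v : Fin k → ℝ := fun i => i
  have hv : Set.InjOn v (Finset.univ : Finset (Fin k)) := fun i _ j _ hij => by
    simpa [v, Fin.ext_iff] using hij
  refine ⟨Lagrange.interpolate Finset.univ v fun i => g (v i), fun x => ?_⟩
  refine tendsto_nhds_unique (h x) ?_
  have key : ∀ n, f n x = (Lagrange.interpolate Finset.univ v fun i => f n (v i)).eval x := by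
    intro n
    rw [hp, Lagrange.eq_interpolate (f := p n) hv (by simpa using hpd n)]
    simp only [hp]
  simp only [key, Lagrange.interpolate_apply, Polynomial.eval_finsetSum, Polynomial.eval_mul,
    Polynomial.eval_C]
  exact tendsto_finsetSum _ fun i _ => (h _).mul_const _

/-- Bochner integrals of functions with values in a closed submodule lie in that submodule. -/
theorem integral_mem_of_isClosed {α B : Type*} [MeasurableSpace α] {μ : Measure α}
    [NormedAddCommGroup B] [NormedSpace ℝ B] [CompleteSpace B] {M : Submodule ℝ B}
    (hM : IsClosed (M : Set B)) {f : α → B} (hf : Integrable f μ) (h : ∀ a, f a ∈ M) :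
    ∫ a, f a ∂μ ∈ M := by
  have : CompleteSpace M := hM.completeSpace_coe
  let g : α → M := fun a => ⟨f a, h a⟩
  have hg : Integrable g μ := by
    refine ⟨?_, hf.2.mono (by simp [g])⟩
    exact (Topology.IsEmbedding.subtypeVal.aestronglyMeasurable_comp_iff (f := g)).1 hf.1
  have := M.subtypeL.integral_comp_comm hg
  have h2 : ∫ a, f a ∂μ = M.subtypeL (∫ a, g a ∂μ) := this
  rw [h2]
  exact (∫ a, g a ∂μ).2

theorem deriv_mem_of_isClosed {B : Type*}
    [NormedAddCommGroup B] [NormedSpace ℝ B] {M : Submodule ℝ B}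
    (hM : IsClosed (M : Set B)) {f : ℝ → B} {f' : B} {a : ℝ} (hf : HasDerivAt f f' a)
    (h : ∀ a, f a ∈ M) : f' ∈ M := by
  rw [hasDerivAt_iff_tendsto_slope] at hf
  refine hM.mem_of_tendsto hf (Eventually.of_forall fun b => ?_)
  rw [slope_def_module]
  exact M.smul_mem _ (M.sub_mem (h _) (h _))

section Ridge
variable {X : Type*} [TopologicalSpace X]

/-- The curve `a ↦ ℓ ^ k * σ ∘ (a ℓ + b)` in `C(X, ℝ)`. -/
def ridgeCurve (σ : C(ℝ, ℝ)) (ℓ : C(X, ℝ)) (k : ℕ) (b a : ℝ) : C(X, ℝ) :=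
  ℓ ^ k * σ.comp (a • ℓ + ContinuousMap.const X b)

theorem continuous_ridgeCurve (σ : C(ℝ, ℝ)) (ℓ : C(X, ℝ)) (k : ℕ) (b : ℝ) :
    Continuous (ridgeCurve σ ℓ k b) := by
  apply ContinuousMap.continuous_of_continuous_uncurry
  simp only [Function.uncurry_def, ridgeCurve, ContinuousMap.mul_apply, ContinuousMap.comp_apply,
    ContinuousMap.pow_apply, ContinuousMap.add_apply, ContinuousMap.smul_apply,
    ContinuousMap.const_apply]
  fun_prop

variable [CompactSpace X]

theorem hasDerivAt_ridgeCurve {σ σ' : C(ℝ, ℝ)} (h : ∀ u, HasDerivAt σ (σ' u) u)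
    (ℓ : C(X, ℝ)) (k : ℕ) (b a : ℝ) :
    HasDerivAt (ridgeCurve σ ℓ k b) (ridgeCurve σ' ℓ (k + 1) b a) a := by
  have hc := continuous_ridgeCurve σ' ℓ (k + 1) b
  have key : ridgeCurve σ ℓ k b =
      fun a => ridgeCurve σ ℓ k b 0 + ∫ t in (0 : ℝ)..a, ridgeCurve σ' ℓ (k + 1) b t := by
    ext a x
    have h1 := (ContinuousMap.evalCLM ℝ x).intervalIntegral_comp_comm
      (hc.intervalIntegrable (μ := volume) 0 a)
    simp only [ContinuousMap.evalCLM_apply] at h1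
    rw [ContinuousMap.add_apply, ← h1, intervalIntegral.integral_eq_sub_of_hasDerivAt
      (f := fun t => ridgeCurve σ ℓ k b t x)]
    · ring
    · intro t _
      have h2 : HasDerivAt (fun t : ℝ => t * ℓ x + b) (ℓ x) t := by
        simpa using ((hasDerivAt_id t).mul_const (ℓ x)).add_const b
      have h3 := ((h (t * ℓ x + b)).comp t h2).const_mul (ℓ x ^ k)
      have e : (fun t => ridgeCurve σ ℓ k b t x) =
          fun t => ℓ x ^ k * (σ ∘ fun t => t * ℓ x + b) t := by
        ext t; simp [ridgeCurve]
      rw [e]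
      refine h3.congr_deriv ?_
      simp [ridgeCurve, pow_succ, mul_assoc, mul_comm, mul_left_comm]
    · exact ((ContinuousMap.evalCLM ℝ x).continuous.comp hc).intervalIntegrable _ _
  rw [key]
  exact (intervalIntegral.integral_hasDerivAt_right (hc.intervalIntegrable _ _)
    (hc.stronglyMeasurableAtFilter _ _) hc.continuousAt).const_add _

theorem ridgeCurve_convolution_eq_integral {φ : ℝ → ℝ} (hφ : Continuous φ)
    (hφc : HasCompactSupport φ) (ρ σ : C(ℝ, ℝ))
    (hσ : ∀ u, σ u = ∫ t, φ t * ρ (u - t)) (ℓ : C(X, ℝ)) (b a : ℝ) :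
    Integrable (fun t => φ t • ridgeCurve ρ ℓ 0 (b - t) a) ∧
    ridgeCurve σ ℓ 0 b a = ∫ t, φ t • ridgeCurve ρ ℓ 0 (b - t) a := by
  have hc : Continuous fun t => φ t • ridgeCurve ρ ℓ 0 (b - t) a := by
    refine hφ.smul (ContinuousMap.continuous_of_continuous_uncurry _ ?_)
    simp only [Function.uncurry_def, ridgeCurve, ContinuousMap.mul_apply, ContinuousMap.comp_apply,
      ContinuousMap.pow_apply, ContinuousMap.add_apply, ContinuousMap.smul_apply,
      ContinuousMap.const_apply]
    fun_prop
  have hi : Integrable fun t => φ t • ridgeCurve ρ ℓ 0 (b - t) a :=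
    hc.integrable_of_hasCompactSupport hφc.smul_right
  refine ⟨hi, ?_⟩
  ext x
  have := (ContinuousMap.evalCLM ℝ x).integral_comp_comm hi
  simp only [ContinuousMap.evalCLM_apply] at this
  rw [← this]
  simp [ridgeCurve, hσ, add_sub_assoc]

theorem ridgeCurve_iteratedDeriv_mem {M : Submodule ℝ C(X, ℝ)}
    (hM : IsClosed (M : Set C(X, ℝ))) {σ : ℝ → ℝ} (hσ : ContDiff ℝ (⊤ : ℕ∞) σ) {ℓ : C(X, ℝ)}
    {b : ℝ} (h : ∀ a, ridgeCurve ⟨σ, hσ.continuous⟩ ℓ 0 b a ∈ M) (k : ℕ) (a : ℝ) :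
    ridgeCurve ⟨iteratedDeriv k σ,
      hσ.continuous_iteratedDeriv k (by exact_mod_cast le_top)⟩ ℓ k b a ∈ M := by
  induction k generalizing a with
  | zero => simpa using h a
  | succ k ih =>
    refine deriv_mem_of_isClosed hM (hasDerivAt_ridgeCurve (fun u => ?_) ℓ k b a) ih
    have := (hσ.differentiable_iteratedDeriv k (by exact_mod_cast WithTop.coe_lt_top _)) u
    simpa [iteratedDeriv_succ] using this.hasDerivAt

/-- If a closed subspace of `C(X, ℝ)` contains all ridge functions `ρ ∘ (a ℓ + b)` for a
nonpolynomial `ρ`, then it contains all powers of `ℓ`. -/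
theorem pow_mem_of_ridge_mem {ρ : C(ℝ, ℝ)} (hρ : ¬ ∃ p : Polynomial ℝ, ∀ u : ℝ, ρ u = p.eval u)
    {M : Submodule ℝ C(X, ℝ)} (hM : IsClosed (M : Set C(X, ℝ))) {ℓ : C(X, ℝ)}
    (h : ∀ a b : ℝ, ρ.comp (a • ℓ + ContinuousMap.const X b) ∈ M) (k : ℕ) : ℓ ^ k ∈ M := by
  by_contra hk
  apply hρ
  let φ : ℕ → ContDiffBump (0 : ℝ) := fun n =>
    ⟨1 / (n + 1 : ℝ) / 2, 1 / (n + 1 : ℝ), by positivity, half_lt_self (by positivity)⟩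
  let σ : ℕ → ℝ → ℝ := fun n u => ∫ t, (φ n).normed volume t * ρ (u - t)
  have hconv : ∀ n, σ n =
      convolution ((φ n).normed volume) ρ (ContinuousLinearMap.lsmul ℝ ℝ) volume := by
    intro n; ext u; simp [σ, convolution_def]
  have hσ : ∀ n, ContDiff ℝ (⊤ : ℕ∞) (σ n) := by
    intro n
    rw [hconv]
    exact (φ n).hasCompactSupport_normed.contDiff_convolution_left _ (φ n).contDiff_normed
      ρ.continuous.locallyIntegrable
  refine exists_polynomial_of_tendsto k (f := σ) (fun n => ?_) (fun x => ?_)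
  · refine exists_polynomial_of_iteratedDeriv_eq_zero k (hσ n) fun b => ?_
    by_contra hb
    apply hk
    have h0 : ∀ a, ridgeCurve ⟨σ n, (hσ n).continuous⟩ ℓ 0 b a ∈ M := by
      intro a
      obtain ⟨hi, he⟩ := ridgeCurve_convolution_eq_integral (φ n).continuous_normed
        (φ n).hasCompactSupport_normed ρ ⟨σ n, (hσ n).continuous⟩ (fun u => rfl) ℓ b a
      rw [he]
      exact integral_mem_of_isClosed hM hi fun t => M.smul_mem _ (by simpa [ridgeCurve] using h a _)
    have h1 := M.smul_mem (iteratedDeriv k (σ n) b)⁻¹ (ridgeCurve_iteratedDeriv_mem hM (hσ n) h0 k 0)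
    convert h1 using 1
    ext x
    simp [ridgeCurve]
    field_simp
  · simp only [hconv]
    refine ContDiffBump.convolution_tendsto_right_of_continuous ?_ ρ.continuous x
    exact tendsto_one_div_add_atTop_nhds_zero_nat

theorem exp_mem_of_pow_mem {M : Submodule ℝ C(X, ℝ)} (hM : IsClosed (M : Set C(X, ℝ)))
    {ℓ : C(X, ℝ)} (h : ∀ k : ℕ, ℓ ^ k ∈ M) : NormedSpace.exp ℓ ∈ M := by
  have := NormedSpace.exp_series_hasSum_exp' (𝕂 := ℝ) ℓ
  exact hM.mem_of_tendsto this (Eventually.of_forall fun s =>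
    M.sum_mem fun i _ => M.smul_mem _ (h i))

theorem exp_apply_eq (ℓ : C(X, ℝ)) (x : X) : NormedSpace.exp ℓ x = Real.exp (ℓ x) := by
  have h1 := (NormedSpace.exp_series_hasSum_exp' (𝕂 := ℝ) ℓ).mapL (ContinuousMap.evalCLM ℝ x)
  have h2 := NormedSpace.exp_series_hasSum_exp' (𝕂 := ℝ) (ℓ x)
  rw [Real.exp_eq_exp_ℝ]
  refine h1.unique ?_
  simpa using h2

/-- Density of ridge functions with respect to a point-separating space of functions on a compact
space. -/
theorem eq_top_of_ridge_mem {ρ : C(ℝ, ℝ)} (hρ : ¬ ∃ p : Polynomial ℝ, ∀ u : ℝ, ρ u = p.eval u)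
    {V M : Submodule ℝ C(X, ℝ)} (hV : ∀ x y : X, x ≠ y → ∃ ℓ ∈ V, ℓ x ≠ ℓ y)
    (hM : IsClosed (M : Set C(X, ℝ)))
    (h : ∀ ℓ ∈ V, ∀ b : ℝ, ρ.comp (ℓ + ContinuousMap.const X b) ∈ M) : M = ⊤ := by
  let P : Submonoid C(X, ℝ) :=
    { carrier := NormedSpace.exp '' (V : Set C(X, ℝ))
      one_mem' := ⟨0, V.zero_mem, NormedSpace.exp_zero⟩
      mul_mem' := by
        rintro _ _ ⟨f, hf, rfl⟩ ⟨g, hg, rfl⟩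
        exact ⟨f + g, V.add_mem hf hg, NormedSpace.exp_add⟩ }
  let A : Subalgebra ℝ C(X, ℝ) := Algebra.adjoin ℝ (P : Set C(X, ℝ))
  have hA : Subalgebra.toSubmodule A ≤ M := by
    rw [Algebra.adjoin_eq_span, Submonoid.closure_eq, Submodule.span_le]
    rintro _ ⟨f, hf, rfl⟩
    exact exp_mem_of_pow_mem hM fun k =>
      pow_mem_of_ridge_mem hρ hM (fun a b => h _ (V.smul_mem a hf) b) k
  have hsep : A.SeparatesPoints := by
    intro x y hxy
    obtain ⟨ℓ, hℓ, hne⟩ := hV x y hxy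
    refine ⟨_, ⟨NormedSpace.exp ℓ, Algebra.subset_adjoin ⟨ℓ, hℓ, rfl⟩, rfl⟩, ?_⟩
    simpa [exp_apply_eq] using hne
  have htop := ContinuousMap.subalgebra_topologicalClosure_eq_top_of_separatesPoints A hsep
  rw [eq_top_iff]
  intro f _
  have hf : f ∈ A.topologicalClosure := by rw [htop]; trivial
  exact closure_minimal (fun g hg => hA hg) hM hf

end Ridge

section Tensor
variable {X B : Type*} [TopologicalSpace X] [CompactSpace X] [T2Space X]
  [NormedAddCommGroup B] [NormedSpace ℝ B]

/-- The map `f ↦ f ⊗ g` from `C(X, ℝ)` to `C(X, B)`. -/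
noncomputable def smulConstCLM (X : Type*) {B : Type*} [TopologicalSpace X] [CompactSpace X]
    [NormedAddCommGroup B] [NormedSpace ℝ B] (g : B) : C(X, ℝ) →L[ℝ] C(X, B) :=
  (ContinuousLinearMap.toSpanSingleton ℝ g).compLeftContinuous ℝ X

omit [T2Space X] in
@[simp] theorem smulConstCLM_apply (g : B) (f : C(X, ℝ)) (x : X) :
    smulConstCLM X g f x = f x • g := rfl

/-- The algebraic tensor product `C(X, ℝ) ⊗ B` is dense in `C(X, B)`. -/
theorem eq_top_of_smulConstCLM_mem {N : Submodule ℝ C(X, B)} (hN : IsClosed (N : Set C(X, B)))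
    (h : ∀ g f, smulConstCLM X g f ∈ N) : N = ⊤ := by
  rw [eq_top_iff]
  intro G _
  rw [← SetLike.mem_coe, ← hN.closure_eq, Metric.mem_closure_iff]
  intro ε hε
  obtain ⟨t, -, ht⟩ := isCompact_univ.elim_nhds_subcover
    (fun x => G ⁻¹' Metric.ball (G x) (ε / 2))
    (fun x _ => G.continuous.continuousAt.preimage_mem_nhds (Metric.ball_mem_nhds _ (by positivity)))
  obtain ⟨f, hf⟩ := PartitionOfUnity.exists_isSubordinate isClosed_univ
    (fun i : t => G ⁻¹' Metric.ball (G i) (ε / 2))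
    (fun i => Metric.isOpen_ball.preimage G.continuous) (by
      intro x hx
      simpa using ht hx)
  refine ⟨∑ i : t, smulConstCLM X (G i) (f i), N.sum_mem fun i _ => h _ _, ?_⟩
  refine lt_of_le_of_lt ?_ (half_lt_self hε)
  rw [ContinuousMap.dist_le (by positivity)]
  intro x
  have hs : ∑ i : t, f i x = 1 := by
    rw [← finsum_eq_sum_of_fintype]; exact f.sum_eq_one (Set.mem_univ x)
  have e : G x = ∑ i : t, f i x • G x := by rw [← Finset.sum_smul, hs, one_smul]
  rw [dist_eq_norm, ContinuousMap.sum_apply, e, ← Finset.sum_sub_distrib]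
  calc _ ≤ ∑ i : t, f i x * (ε / 2) := by
        refine norm_sum_le_of_le _ fun i _ => ?_
        rw [smulConstCLM_apply, ← smul_sub, norm_smul, Real.norm_of_nonneg (f.nonneg i x)]
        by_cases hx : f i x = 0
        · simp [hx]
        · refine mul_le_mul_of_nonneg_left ?_ (f.nonneg i x)
          have := hf i (subset_tsupport _ (Function.mem_support.2 hx))
          rw [← dist_eq_norm]
          exact (Set.mem_preimage.1 this).le
    _ = ε / 2 := by rw [← Finset.sum_mul, hs, one_mul]

/-- Vector-valued density of ridge functions. -/
theorem eq_top_of_smulConstCLM_ridge_mem {ρ : C(ℝ, ℝ)}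
    (hρ : ¬ ∃ p : Polynomial ℝ, ∀ u : ℝ, ρ u = p.eval u)
    {V : Submodule ℝ C(X, ℝ)} (hV : ∀ x y : X, x ≠ y → ∃ ℓ ∈ V, ℓ x ≠ ℓ y)
    {N : Submodule ℝ C(X, B)} (hN : IsClosed (N : Set C(X, B)))
    (h : ∀ g, ∀ ℓ ∈ V, ∀ b : ℝ, smulConstCLM X g (ρ.comp (ℓ + ContinuousMap.const X b)) ∈ N) :
    N = ⊤ := by
  refine eq_top_of_smulConstCLM_mem hN fun g f => ?_
  have := eq_top_of_ridge_mem hρ hV (M := N.comap (smulConstCLM X g).toLinearMap)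
    (hN.preimage (smulConstCLM X g).continuous) (fun ℓ hℓ b => h g ℓ hℓ b)
  have hf : f ∈ N.comap (smulConstCLM X g).toLinearMap := by rw [this]; trivial
  exact hf

end Tensor

section Functional
open scoped CompactlySupported
variable {S : Type*} [TopologicalSpace S] [MeasurableSpace S] [BorelSpace S]
  (μ : Measure S) [IsFiniteMeasureOnCompacts μ]

theorem integrable_compactlySupported_mul (w : C_c(S, ℝ)) (x : C(S, ℝ)) :
    Integrable (fun s => w s * x s) μ :=
  (w.continuous.mul x.continuous).integrable_of_hasCompactSupport w.hasCompactSupport.mul_right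

/-- The continuous linear functional `x ↦ ∫ w x dμ` on `C(S, ℝ)`. -/
noncomputable def integralMulCLM (w : C_c(S, ℝ)) : C(S, ℝ) →L[ℝ] ℝ where
  toFun x := ∫ s, w s * x s ∂μ
  map_add' x y := by
    simp only [ContinuousMap.add_apply, mul_add]
    exact integral_add (integrable_compactlySupported_mul μ w x)
      (integrable_compactlySupported_mul μ w y)
  map_smul' c x := by
    simp only [ContinuousMap.smul_apply, smul_eq_mul, RingHom.id_apply, ← integral_const_mul]
    congr 1 with s
    ring
  cont := by
    rw [continuous_iff_continuousAt]
    intro x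
    rw [ContinuousAt, Metric.tendsto_nhds]
    intro ε hε
    have hx : Tendsto id (𝓝 x) (𝓝 x) := tendsto_id
    rw [ContinuousMap.tendsto_iff_forall_isCompact_tendstoUniformlyOn] at hx
    have hw : 0 ≤ ∫ s, ‖w s‖ ∂μ := integral_nonneg fun _ => norm_nonneg _
    have hwi : Integrable (fun s => ‖w s‖) μ :=
      (w.continuous.integrable_of_hasCompactSupport w.hasCompactSupport).norm
    have hδ : 0 < ε / (∫ s, ‖w s‖ ∂μ + 1) := by positivity
    filter_upwards [Metric.tendstoUniformlyOn_iff.1 (hx _ w.hasCompactSupport) _ hδ] with y hy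
    rw [dist_eq_norm, ← integral_sub (integrable_compactlySupported_mul μ w y)
      (integrable_compactlySupported_mul μ w x)]
    calc ‖∫ s, (w s * y s - w s * x s) ∂μ‖
        ≤ ∫ s, ‖w s‖ * (ε / (∫ s, ‖w s‖ ∂μ + 1)) ∂μ := by
          refine norm_integral_le_of_norm_le (hwi.mul_const _) (Eventually.of_forall fun s => ?_)
          rw [← mul_sub, norm_mul]
          by_cases hs : w s = 0
          · simp [hs]
          · refine mul_le_mul_of_nonneg_left ?_ (norm_nonneg _)
            have := hy s (subset_tsupport _ (Function.mem_support.2 hs))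
            rw [dist_comm, dist_eq_norm] at this
            exact this.le
      _ = (∫ s, ‖w s‖ ∂μ) * (ε / (∫ s, ‖w s‖ ∂μ + 1)) := integral_mul_const _ _
      _ < ε := by
        rw [mul_div_assoc', div_lt_iff₀ (by positivity)]
        nlinarith

theorem integralMulCLM_apply (w : C_c(S, ℝ)) (x : C(S, ℝ)) :
    integralMulCLM μ w x = ∫ s, w s * x s ∂μ := rfl

theorem exists_integralMulCLM_ne_zero [LocallyCompactSpace S] [T2Space S] [μ.IsOpenPosMeasure]
    {x : C(S, ℝ)} (hx : x ≠ 0) : ∃ w : C_c(S, ℝ), integralMulCLM μ w x ≠ 0 := by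
  obtain ⟨s, hs⟩ : ∃ s, x s ≠ 0 := by
    by_contra! h; exact hx (ContinuousMap.ext h)
  obtain ⟨φ, hφ1, -, hφc, hφ⟩ := exists_continuous_one_zero_of_isCompact
    (isCompact_singleton (x := s)) isClosed_empty (by simp)
  have hc : HasCompactSupport (φ * x) := hφc.mul_right
  refine ⟨⟨φ * x, hc⟩, ?_⟩
  have : 0 < ∫ s, φ s * x s * x s ∂μ := by
    refine Continuous.integral_pos_of_hasCompactSupport_nonneg_nonzero (x := s) (by fun_prop)
      hc.mul_right (fun s => ?_) ?_
    · have := mul_nonneg (hφ s).1 (mul_self_nonneg (x s))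
      simpa [mul_assoc] using this
    · have : φ s = 1 := hφ1 rfl
      simp [this, hs]
  exact this.ne'

omit [MeasurableSpace S] [BorelSpace S] in
theorem continuous_zeroAtInfty_toContinuousMap :
    Continuous fun x : C₀(S, ℝ) => x.toContinuousMap := by
  refine continuous_iff_continuousAt.2 fun x => ?_
  refine ContinuousMap.tendsto_of_tendstoLocallyUniformly ?_
  exact (ZeroAtInftyContinuousMap.tendsto_iff_tendstoUniformly.1
    (tendsto_id (x := 𝓝 x))).tendstoLocallyUniformly

/-- The functionals `x ↦ ∫ w x dμ`, restricted to a set of functions vanishing at infinity. -/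
noncomputable def integralMulOn (E : Set C₀(S, ℝ)) : C_c(S, ℝ) →ₗ[ℝ] C(E, ℝ) where
  toFun w := ⟨fun x => integralMulCLM μ w (x : C₀(S, ℝ)).toContinuousMap, 
    (integralMulCLM μ w).continuous.comp
      (continuous_zeroAtInfty_toContinuousMap.comp continuous_subtype_val)⟩
  map_add' w v := by
    ext x
    simp only [ContinuousMap.coe_mk, ContinuousMap.add_apply, integralMulCLM_apply]
    rw [← integral_add (integrable_compactlySupported_mul μ w _)
      (integrable_compactlySupported_mul μ v _)]
    simp [add_mul]
  map_smul' c w := by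
    ext x
    simp only [ContinuousMap.coe_mk, ContinuousMap.smul_apply, integralMulCLM_apply]
    simp [← integral_const_mul, mul_assoc]

theorem integralMulOn_separatesPoints [LocallyCompactSpace S] [T2Space S] [μ.IsOpenPosMeasure]
    (E : Set C₀(S, ℝ)) (x y : E) (hxy : x ≠ y) :
    ∃ ℓ ∈ LinearMap.range (integralMulOn μ E), ℓ x ≠ ℓ y := by
  have h : (x : C₀(S, ℝ)).toContinuousMap - (y : C₀(S, ℝ)).toContinuousMap ≠ 0 := by
    rw [sub_ne_zero]
    exact fun h => hxy (Subtype.ext (ZeroAtInftyContinuousMap.ext fun s => DFunLike.congr_fun h s))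
  obtain ⟨w, hw⟩ := exists_integralMulCLM_ne_zero μ h
  rw [map_sub, sub_ne_zero] at hw
  exact ⟨_, ⟨w, rfl⟩, hw⟩

end Functional

section Domain
variable {d : ℕ} {S : Set (EuclideanSpace ℝ (Fin d))}

theorem IsEuclideanDomain.measurableSet (hS : IsEuclideanDomain S) : MeasurableSet S := by
  have := hS.locallyCompact
  obtain ⟨K, hK, hKS⟩ := isSigmaCompact_iff_sigmaCompactSpace.2 (inferInstance : SigmaCompactSpace S)
  rw [← hKS]
  exact MeasurableSet.iUnion fun n => (hK n).measurableSet

theorem IsEuclideanDomain.isFiniteMeasureOnCompacts (hS : IsEuclideanDomain S) :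
    IsFiniteMeasureOnCompacts (Measure.comap (Subtype.val : S → _) volume) :=
  IsFiniteMeasureOnCompacts.comap' _ continuous_subtype_val
    (MeasurableEmbedding.subtype_coe hS.measurableSet)

theorem IsEuclideanDomain.regular (hS : IsEuclideanDomain S) :
    (Measure.comap (Subtype.val : S → _) volume).Regular := by
  have := hS.locallyCompact
  have := hS.isFiniteMeasureOnCompacts
  infer_instance

theorem IsEuclideanDomain.isOpenPosMeasure (hS : IsEuclideanDomain S) :
    (Measure.comap (Subtype.val : S → _) volume).IsOpenPosMeasure where
  open_pos U hU hne := by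
    obtain ⟨V, hV, rfl⟩ := isOpen_induced_iff.1 hU
    obtain ⟨s, hs⟩ := hne
    have h1 : (V ∩ interior S).Nonempty :=
      mem_closure_iff.1 (hS.subset_closure_interior s.2) V hV hs
    rw [(MeasurableEmbedding.subtype_coe hS.measurableSet).comap_apply]
    refine ((hV.inter isOpen_interior).measure_pos volume h1).trans_le (measure_mono ?_) |>.ne'
    rintro x ⟨hx, hxS⟩
    exact ⟨⟨x, interior_subset hxS⟩, hx, rfl⟩

end Domain

section Network
open scoped CompactlySupported

/-- The bounded affine map `C(S) → ℝ^N` with weights `w j` and biases `b j`. -/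
noncomputable def BoundedAffineMap.ofWeights {S : Type*} [TopologicalSpace S] [MeasurableSpace S]
    [BorelSpace S] (μ : Measure S) [hμ : μ.Regular] {N : ℕ}
    (w : Fin N → C_c(S, ℝ)) (b : Fin N → ℝ) : BoundedAffineMap S (Fin N) where
  measure := μ
  regular := hμ
  kernel j s := w j s
  integrable_kernel j := (w j).continuous.integrable_of_hasCompactSupport (w j).hasCompactSupport
  linear := ∑ j, (integralMulCLM μ (w j)).smulRight
    (⟨Pi.single j 1, continuous_of_discreteTopology⟩ : C(Fin N, ℝ))
  integrable_kernel_mul x j := integrable_compactlySupported_mul μ (w j) x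
  linear_apply x j := by
    simp [integralMulCLM_apply, Pi.single_apply]
  bias := ⟨b, continuous_of_discreteTopology⟩

theorem BoundedAffineMap.ofWeights_eval {S : Type*} [TopologicalSpace S] [MeasurableSpace S]
    [BorelSpace S] (μ : Measure S) [μ.Regular] {N : ℕ}
    (w : Fin N → C_c(S, ℝ)) (b : Fin N → ℝ) (x : C(S, ℝ)) (j : Fin N) :
    (BoundedAffineMap.ofWeights μ w b).eval x j = integralMulCLM μ (w j) x + b j := by
  rw [BoundedAffineMap.eval, ContinuousMap.add_apply, BoundedAffineMap.linear_apply]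
  rfl

/-- The linear map `ℝ^N → C(T)`, `y ↦ ∑ j, y j * g j`, as a bounded affine map. -/
noncomputable def BoundedAffineMap.ofColumns {T : Type*} [TopologicalSpace T] {N : ℕ}
    (g : Fin N → C(T, ℝ)) : BoundedAffineMap (Fin N) T where
  measure := Measure.count
  regular := inferInstance
  kernel t j := g j t
  integrable_kernel _ := Integrable.of_finite
  linear := ∑ j, (ContinuousMap.evalCLM ℝ j).smulRight (g j)
  integrable_kernel_mul _ _ := Integrable.of_finite
  linear_apply y t := by
    simp [integral_fintype, mul_comm]
  bias := 0

theorem BoundedAffineMap.ofColumns_eval {T : Type*} [TopologicalSpace T] {N : ℕ}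
    (g : Fin N → C(T, ℝ)) (y : C(Fin N, ℝ)) (t : T) :
    (BoundedAffineMap.ofColumns g).eval y t = ∑ j, y j * g j t := by
  simp [BoundedAffineMap.eval, BoundedAffineMap.ofColumns]

end Network

theorem mainTheorem3
    (ρ : C(ℝ, ℝ)) (hρ : ¬ ∃ p : Polynomial ℝ, ∀ u : ℝ, ρ u = p.eval u)
    {d d' : ℕ} (S : Set (EuclideanSpace ℝ (Fin d))) (T : Set (EuclideanSpace ℝ (Fin d')))
    (hS : IsEuclideanDomain S) (hT : IsEuclideanDomain T)
    (F : C₀(S, ℝ) → C₀(T, ℝ)) (hF : ∃ L, LipschitzWith L F)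
    (E : Set C₀(S, ℝ)) (hE : IsCompact E) (ε : ℝ) (hε : 0 < ε) :
    ∃ N : ℕ, 1 ≤ N ∧
      ∃ (A₁ : BoundedAffineMap S (Fin N)) (A₂ : BoundedAffineMap (Fin N) T),
        A₁.measure = Measure.comap Subtype.val volume ∧
        (∀ y : C(Fin N, ℝ), Tendsto (A₂.eval y) (cocompact T) (𝓝 0)) ∧
        supDistOn E F (twoLayerFNN ρ A₁ A₂) < ENNReal.ofReal ε := by
  have := hS.locallyCompact
  have := hS.regular
  have := hS.isOpenPosMeasure
  set μ : Measure S := Measure.comap Subtype.val volume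
  have : CompactSpace E := isCompact_iff_compactSpace.1 hE
  obtain ⟨L, hL⟩ := hF
  let ridge : (CompactlySupportedContinuousMap S ℝ × ℝ) × C₀(T, ℝ) → C(E, C₀(T, ℝ)) := fun q =>
    smulConstCLM E q.2 (ρ.comp (integralMulOn μ E q.1.1 + ContinuousMap.const E q.1.2))
  let G : C(E, C₀(T, ℝ)) := ⟨fun x => F x, hL.continuous.comp continuous_subtype_val⟩
  have htop : (Submodule.span ℝ (Set.range ridge)).topologicalClosure = ⊤ := by
    refine eq_top_of_smulConstCLM_ridge_mem hρ (integralMulOn_separatesPoints μ E)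
      (Submodule.isClosed_topologicalClosure _) ?_
    rintro g _ ⟨w, rfl⟩ b
    exact Submodule.le_topologicalClosure _ (Submodule.subset_span ⟨((w, b), g), rfl⟩)
  have hG : G ∈ closure (Submodule.span ℝ (Set.range ridge) : Set C(E, C₀(T, ℝ))) := by
    rw [← Submodule.topologicalClosure_coe, htop]; trivial
  obtain ⟨H, hH, hGH⟩ := Metric.mem_closure_iff.1 hG (ε / 2) (by positivity)
  obtain ⟨n, c, q', hq'⟩ := Submodule.mem_span_set'.1 hH
  choose q hq using fun i => (q' i).2
  let r : Fin (n + 1) → (CompactlySupportedContinuousMap S ℝ × ℝ) × C₀(T, ℝ) :=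
    Fin.cons 0 fun i => ((q i).1, c i • (q i).2)
  have hsum : ∀ (x : E) (t : T), H x t =
      ∑ j, ρ (integralMulCLM μ (r j).1.1 (x : C₀(S, ℝ)).toContinuousMap + (r j).1.2) *
        (r j).2 t := by
    intro x t
    have ht : ∀ f : Fin n → C₀(T, ℝ), (∑ i, f i) t = ∑ i, f i t := fun f =>
      map_sum (⟨⟨fun g => g t, rfl⟩, fun _ _ => rfl⟩ : C₀(T, ℝ) →+ ℝ) f Finset.univ
    rw [← hq', Fin.sum_univ_succ, ContinuousMap.sum_apply, ht]
    simp only [← hq, r, ridge, Fin.cons_zero, Fin.cons_succ]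
    simp [integralMulOn]
    refine Finset.sum_congr rfl fun i _ => ?_
    ring
  refine ⟨n + 1, by omega, BoundedAffineMap.ofWeights μ (fun j => (r j).1.1) (fun j => (r j).1.2),
    BoundedAffineMap.ofColumns fun j => (r j).2.toContinuousMap, rfl, fun y => ?_, ?_⟩
  · have h : Tendsto (fun t => ∑ j, y j * (r j).2 t) (cocompact T) (𝓝 (∑ j, y j * 0)) :=
      tendsto_finsetSum _ fun j _ => (zero_at_infty (r j).2).const_mul (y j)
    simp only [mul_zero, Finset.sum_const_zero] at h
    exact h.congr fun t => (BoundedAffineMap.ofColumns_eval _ y t).symm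
  · refine lt_of_le_of_lt (b := ENNReal.ofReal (ε / 2)) ?_
      ((ENNReal.ofReal_lt_ofReal_iff hε).2 (half_lt_self hε))
    refine iSup₂_le fun x hx => iSup_le fun t => ENNReal.ofReal_le_ofReal ?_
    have e : twoLayerFNN ρ (BoundedAffineMap.ofWeights μ (fun j => (r j).1.1) (fun j => (r j).1.2))
        (BoundedAffineMap.ofColumns fun j => (r j).2.toContinuousMap) x.toContinuousMap t =
        H ⟨x, hx⟩ t := by
      rw [twoLayerFNN, BoundedAffineMap.ofColumns_eval, hsum]
      refine Finset.sum_congr rfl fun j _ => ?_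
      rw [activationMap, ContinuousMap.comp_apply, BoundedAffineMap.ofWeights_eval]
      rfl
    rw [e]
    have h1 := (ContinuousMap.dist_apply_le_dist (f := G) (g := H) ⟨x, hx⟩).trans hGH.le
    rw [← ZeroAtInftyContinuousMap.dist_toBCF_eq_dist] at h1
    have h2 := (BoundedContinuousFunction.dist_coe_le_dist t).trans h1
    rw [Real.dist_eq] at h2
    exact h2
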